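/- There is an absolute constant $K>0$ such that the following holds. Let $A,D\subset\mathbb{R}$ be finite sets, let $N\ge 1$ be an integer, let $\omega\in\mathbb{R}$ with $|\omega|\ge 2$, and put $\omega\cdot[N]=\{\omega n : n=1,\dots,N\}$. Let $$\sigma=\bigl|\{(a,b,d) : a\in A,\ b\in\omega\cdot[N],\ d\in D,\ (a+b)(b+d)=1\}\bigr| .$$ Then $$\sigma\le K\sqrt{|A||D|}\,N\,\max\{|D|^{-1/2},N^{-1/5}\}$$ (if $D=\emptyset$, the right-hand side is read as $0$). Moreover, if $|D|^2\ge N^{l}$ for some real $l>0$, then $$\sigma\le K\sqrt{|A||D|}\,N^{2/3}\,|D|^{1/(6l)} .$$ -/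

import Mathlib

/-- The dilated interval `ω · [N] = {ω n : n = 1, …, N}`. -/
noncomputable def dilatedInterval (ω : ℝ) (N : ℕ) : Finset ℝ :=
  (Finset.Icc 1 N).image (fun n : ℕ => ω * (n : ℝ))

/-- The solutions `(a, b, d)` of `(a + b) (b + d) = 1` with `a ∈ A`, `b ∈ B`, `d ∈ D`. -/
noncomputable def hyperbolaSolutions (A B D : Finset ℝ) : Finset (ℝ × ℝ × ℝ) :=
  (A ×ˢ B ×ˢ D).filter (fun t => (t.1 + t.2.1) * (t.2.1 + t.2.2) = 1)

/-! In a solution one of the factors `a + b`, `b + d` has modulus at most 1; by symmetry let it be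
`a + b`. Then `b` lies within 1 of `-a`, and the spacing `|ω| ≥ 2` leaves at most two such `b` for
each `a`, so there are at most `2|A|` solutions. The trivial bound is `N|D|`. The geometric mean of
the two gives `O(√(|A||D|N))`, and `N^{1/2}` is below both `N^{4/5}` and `N^{2/3}`. -/

/-- The solutions `(a, b, d)` of `(a + b) (b + d) = 1` with `|a + b| ≤ 1`. -/
noncomputable def contractingSolutions (A B D : Finset ℝ) : Finset (ℝ × ℝ × ℝ) :=
  (hyperbolaSolutions A B D).filter (fun t => |t.1 + t.2.1| ≤ 1)

theorem mem_hyperbolaSolutions {A B D : Finset ℝ} {a b d : ℝ} :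
    (a, b, d) ∈ hyperbolaSolutions A B D ↔
      (a ∈ A ∧ b ∈ B ∧ d ∈ D) ∧ (a + b) * (b + d) = 1 := by
  simp [hyperbolaSolutions]

theorem mem_contractingSolutions {A B D : Finset ℝ} {a b d : ℝ} :
    (a, b, d) ∈ contractingSolutions A B D ↔
      ((a ∈ A ∧ b ∈ B ∧ d ∈ D) ∧ (a + b) * (b + d) = 1) ∧ |a + b| ≤ 1 := by
  simp [contractingSolutions, hyperbolaSolutions]

theorem card_dilatedInterval_le (ω : ℝ) (N : ℕ) : (dilatedInterval ω N).card ≤ N :=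
  Finset.card_image_le.trans (by simp)

/-- Distinct elements of `ω · [N]` are at distance at least `|ω|`. -/
theorem eq_of_mem_dilatedInterval_of_abs_sub_lt {ω b c : ℝ} {N : ℕ}
    (hb : b ∈ dilatedInterval ω N) (hc : c ∈ dilatedInterval ω N) (h : |b - c| < |ω|) :
    b = c := by
  obtain ⟨m, -, rfl⟩ := Finset.mem_image.1 hb
  obtain ⟨n, -, rfl⟩ := Finset.mem_image.1 hc
  have h0 : 0 < |ω| := (abs_nonneg _).trans_lt h
  rw [← mul_sub, abs_mul] at h
  have h1 : |(m : ℝ) - n| < 1 := by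
    by_contra! h2
    exact absurd h (not_lt.2 (le_mul_of_one_le_right h0.le h2))
  have h2 : |(m : ℤ) - n| < 1 := by exact_mod_cast h1
  have h3 : (m : ℤ) = n := sub_eq_zero.1 (Int.abs_lt_one_iff.1 h2)
  have h4 : m = n := by exact_mod_cast h3
  rw [h4]

theorem card_hyperbolaSolutions_le (A B D : Finset ℝ) :
    (hyperbolaSolutions A B D).card ≤
      (contractingSolutions A B D).card + (contractingSolutions D B A).card := by
  classical
  have h : hyperbolaSolutions A B D ⊆ contractingSolutions A B D ∪
      (contractingSolutions D B A).image (fun t => (t.2.2, t.2.1, t.1)) := by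
    rintro ⟨a, b, d⟩ ht
    rw [Finset.mem_union, Finset.mem_image]
    obtain ⟨⟨ha, hb, hd⟩, he⟩ := mem_hyperbolaSolutions.1 ht
    rcases le_or_gt |a + b| 1 with h1 | h1
    · exact Or.inl (mem_contractingSolutions.2 ⟨⟨⟨ha, hb, hd⟩, he⟩, h1⟩)
    · refine Or.inr ⟨(d, b, a), mem_contractingSolutions.2
        ⟨⟨⟨hd, hb, ha⟩, by linarith⟩, ?_⟩, rfl⟩
      have h2 : |a + b| * |b + d| = 1 := by rw [← abs_mul, he, abs_one]
      rw [add_comm d b]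
      by_contra! h3
      exact absurd h2 (one_lt_mul_of_lt_of_le h1 h3.le).ne'
  exact (Finset.card_le_card h).trans
    ((Finset.card_union_le _ _).trans (Nat.add_le_add_left Finset.card_image_le _))

/-- The pair `(b, d)` determines `a`, since `b + d ≠ 0`. -/
theorem card_contractingSolutions_le_mul (A B D : Finset ℝ) :
    (contractingSolutions A B D).card ≤ B.card * D.card := by
  rw [← Finset.card_product]
  refine Finset.card_le_card_of_injOn (fun t => t.2) ?_ ?_
  · rintro ⟨a, b, d⟩ ht
    have h := mem_contractingSolutions.1 ht
    exact Finset.mem_product.2 h.1.1.2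
  · rintro ⟨a, b, d⟩ ht ⟨a', b', d'⟩ ht' h
    obtain ⟨⟨-, he⟩, -⟩ := mem_contractingSolutions.1 ht
    obtain ⟨⟨-, he'⟩, -⟩ := mem_contractingSolutions.1 ht'
    obtain ⟨rfl, rfl⟩ := Prod.mk.inj h
    have h0 : b + d ≠ 0 := right_ne_zero_of_mul_eq_one he
    have h1 : a + b = a' + b := mul_right_cancel₀ h0 (he.trans he'.symm)
    rw [add_right_cancel h1]

/-- As `|ω| ≥ 2`, an element `a` and the sign of `a + b` determine `b ∈ ω · [N]` with
`|a + b| ≤ 1`. -/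
theorem card_contractingSolutions_le_two_mul (A D : Finset ℝ) (N : ℕ) {ω : ℝ} (hω : 2 ≤ |ω|) :
    (contractingSolutions A (dilatedInterval ω N) D).card ≤ A.card * 2 := by
  classical
  rw [← Fintype.card_bool, ← Finset.card_univ, ← Finset.card_product]
  refine Finset.card_le_card_of_injOn (fun t => (t.1, decide (0 ≤ t.1 + t.2.1))) ?_ ?_
  · rintro ⟨a, b, d⟩ ht
    have h := mem_contractingSolutions.1 ht
    exact Finset.mem_product.2 ⟨h.1.1.1, Finset.mem_univ _⟩
  · rintro ⟨a, b, d⟩ ht ⟨a', b', d'⟩ ht' h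
    obtain ⟨⟨⟨-, hb, -⟩, he⟩, hs⟩ := mem_contractingSolutions.1 ht
    obtain ⟨⟨⟨-, hb', -⟩, he'⟩, hs'⟩ := mem_contractingSolutions.1 ht'
    obtain ⟨rfl, h⟩ := Prod.mk.inj h
    have hiff : 0 ≤ a + b ↔ 0 ≤ a + b' := decide_eq_decide.1 h
    rw [abs_le] at hs hs'
    have hbb : b = b' := by
      -- `a + b` and `a + b'` lie on the same side of 0 in `[-1, 1]`, so they differ by at most 1.
      refine eq_of_mem_dilatedInterval_of_abs_sub_lt hb hb' (lt_of_lt_of_le ?_ hω)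
      rw [abs_lt]
      rcases le_or_gt 0 (a + b) with h0 | h0
      · have := hiff.1 h0
        constructor <;> linarith
      · have := not_le.1 (mt hiff.2 h0.not_ge)
        constructor <;> linarith
    subst hbb
    have h0 : a + b ≠ 0 := left_ne_zero_of_mul_eq_one he
    have h1 : b + d = b + d' := mul_left_cancel₀ h0 (he.trans he'.symm)
    rw [add_left_cancel h1]

theorem card_contractingSolutions_le_sqrt (A D : Finset ℝ) (N : ℕ) {ω : ℝ} (hω : 2 ≤ |ω|) :
    ((contractingSolutions A (dilatedInterval ω N) D).card : ℝ) ≤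
      2 * (√((A.card : ℝ) * D.card) * √N) := by
  set s := (contractingSolutions A (dilatedInterval ω N) D).card
  have h1 : s ≤ A.card * 2 := card_contractingSolutions_le_two_mul A D N hω
  have h2 : s ≤ N * D.card := (card_contractingSolutions_le_mul _ _ _).trans
    (Nat.mul_le_mul_right _ (card_dilatedInterval_le ω N))
  have h3 : (s : ℝ) * s ≤ (A.card * 2) * (N * D.card) := by exact_mod_cast Nat.mul_le_mul h1 h2
  have h4 : 0 ≤ (A.card : ℝ) * D.card * N := by positivity
  rw [← Real.sqrt_mul (by positivity)]
  refine abs_le_of_sq_le_sq' ?_ (by positivity) |>.2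
  rw [mul_pow, Real.sq_sqrt h4]
  nlinarith

/-- The number of solutions is at most `4 √(|A| |D| N)`. -/
theorem card_hyperbolaSolutions_dilatedInterval_le (A D : Finset ℝ) (N : ℕ) {ω : ℝ}
    (hω : 2 ≤ |ω|) :
    ((hyperbolaSolutions A (dilatedInterval ω N) D).card : ℝ) ≤
      4 * (√((A.card : ℝ) * D.card) * √N) := by
  have h1 := card_contractingSolutions_le_sqrt A D N hω
  have h2 := card_contractingSolutions_le_sqrt D A N hω
  rw [mul_comm (D.card : ℝ)] at h2
  have h3 : ((hyperbolaSolutions A (dilatedInterval ω N) D).card : ℝ) ≤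
      (contractingSolutions A (dilatedInterval ω N) D).card +
        (contractingSolutions D (dilatedInterval ω N) A).card := by
    exact_mod_cast card_hyperbolaSolutions_le A (dilatedInterval ω N) D
  linarith

theorem mainTheorem7 :
    ∃ K : ℝ, 0 < K ∧
      ∀ (A D : Finset ℝ) (N : ℕ) (ω : ℝ), 1 ≤ N → 2 ≤ |ω| →
        (((hyperbolaSolutions A (dilatedInterval ω N) D).card : ℝ) ≤
          K * (Real.sqrt ((A.card : ℝ) * (D.card : ℝ)) * (N : ℝ) *
            max ((D.card : ℝ) ^ (-(1 / 2) : ℝ)) ((N : ℝ) ^ (-(1 / 5) : ℝ)))) ∧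
        (∀ l : ℝ, 0 < l → (N : ℝ) ^ l ≤ (D.card : ℝ) ^ 2 →
          ((hyperbolaSolutions A (dilatedInterval ω N) D).card : ℝ) ≤
            K * (Real.sqrt ((A.card : ℝ) * (D.card : ℝ)) * (N : ℝ) ^ (2 / 3 : ℝ) *
              (D.card : ℝ) ^ (1 / (6 * l) : ℝ))) := by
  refine ⟨4, by norm_num, fun A D N ω hN hω => ?_⟩
  have hN' : (1 : ℝ) ≤ N := by exact_mod_cast hN
  have hN0 : (0 : ℝ) < N := by linarith
  have key := card_hyperbolaSolutions_dilatedInterval_le A D N hω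
  refine ⟨key.trans ?_, fun l hl _ => ?_⟩
  · rw [mul_assoc √_]
    gcongr
    calc √(N : ℝ) = (N : ℝ) ^ (1 / 2 : ℝ) := Real.sqrt_eq_rpow _
      _ ≤ (N : ℝ) ^ (1 + -(1 / 5) : ℝ) := Real.rpow_le_rpow_of_exponent_le hN' (by norm_num)
      _ = N * (N : ℝ) ^ (-(1 / 5) : ℝ) := by rw [Real.rpow_add hN0, Real.rpow_one]
      _ ≤ _ := mul_le_mul_of_nonneg_left (le_max_right _ _) hN0.le
  -- The last factor is at least 1 only for `|D| ≥ 1`; for empty `D` the count is 0.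
  · rcases D.eq_empty_or_nonempty with rfl | hD
    · simpa using key
    · refine key.trans ?_
      have hD' : (1 : ℝ) ≤ D.card := by exact_mod_cast hD.card_pos
      rw [mul_assoc √_]
      gcongr
      calc √(N : ℝ) = (N : ℝ) ^ (1 / 2 : ℝ) := Real.sqrt_eq_rpow _
        _ ≤ (N : ℝ) ^ (2 / 3 : ℝ) := Real.rpow_le_rpow_of_exponent_le hN' (by norm_num)
        _ ≤ _ := le_mul_of_one_le_right (by positivity)
          (Real.one_le_rpow hD' (by positivity))
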